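/- Let $\Lambda$ be a principal ideal domain and $p\in\Lambda$ a prime element. A pair $(B;A)$ consists of a finitely generated $\Lambda$-module $B$ and a submodule $A\subseteq B$; in addition we always assume $p^2A=0$. An isomorphism $(B;A)\cong(D;C)$ is a $\Lambda$-isomorphism $f:B\to D$ with $f(A)=C$. A pair $(B;A)$ is indecomposable if $B\neq 0$ and, whenever $B=B_1\oplus B_2$ and $A=A_1\oplus A_2$ with $A_i\subseteq B_i$, one has $B_1=0$ or $B_2=0$. For a nonzero element $a$ of a $\Lambda$-module $B$, the height exponent is $h_B(a)=\max\{n\ge 0 : a\in p^nB\}$; the height sequence $H_B(a)=(h_B(a),h_B(pa),\dots,h_B(p^{\ell}a))$ is the finite sequence of the height exponents of the nonzero elements among $a,pa,p^2a,\dots$ (defined when $a$ is annihilated by a power of $p$ and the maxima exist). By a power of a prime ideal we mean $P^k$ with $k\ge 1$ and $P$ a prime ideal, where $P=0$ is allowed. Every indecomposable pair $(B;A)$ with $p^2A=0$ is of exactly one of the following two kinds. (1) $(B;A)\cong(\Lambda/Q;0)$ for a unique power $Q$ of a prime ideal of $\Lambda$. (2) $A=a\Lambda$ for some nonzero $a\in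 B$. In this case, for each generator $a$ of $A$, the height sequence $H_B(a)$ exists and has length at most $2$, and it determines the pair up to isomorphism: if $(B;a\Lambda)$ and $(D;c\Lambda)$ are indecomposable pairs with $a,c\ne 0$ and $p^2a=0$, $p^2c=0$, then $(B;a\Lambda)\cong(D;c\Lambda)$ if and only if $H_B(a)=H_D(c)$. Conversely, for every power $Q$ of a prime ideal of $\Lambda$ the pair $(\Lambda/Q;0)$ is indecomposable. Moreover, the height sequence of a nonzero element of any $\Lambda$-module, whenever defined, is a nonempty strictly increasing finite sequence of non-negative integers, and every strictly increasing sequence of non-negative integers of length $1$ or $2$ equals $H_B(a)$ for some indecomposable pair $(B;a\Lambda)$ with $a\neq 0$ and $p^2a=0$. -/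

import Mathlib

namespace SubmodulePair

variable {R : Type*} [CommRing R] {M : Type*} [AddCommGroup M] [Module R M]
  {N : Type*} [AddCommGroup N] [Module R N]

/-- The pairs `(M; A)` and `(N; C)` are isomorphic: some linear isomorphism `M ≃ N` maps `A`
onto `C`. -/
def PairIso (A : Submodule R M) (C : Submodule R N) : Prop :=
  ∃ e : M ≃ₗ[R] N, A.map (e : M →ₗ[R] N) = C

/-- The pair `(M; A)` is indecomposable: `M` is nonzero, and whenever
`(M; A) = (M₁; A₁) ⊕ (M₂; A₂)`, that is `M = M₁ ⊕ M₂`, `A₁ ⊆ M₁`, `A₂ ⊆ M₂` and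
`A = A₁ ⊕ A₂`, one of the two summands is the zero pair. -/
def IsIndecomposablePair (A : Submodule R M) : Prop :=
  Nontrivial M ∧
    ∀ M₁ M₂ A₁ A₂ : Submodule R M, IsCompl M₁ M₂ → A₁ ≤ M₁ → A₂ ≤ M₂ → A = A₁ ⊔ A₂ →
      M₁ = ⊥ ∨ M₂ = ⊥

/-- `A` is `p ^ m`-bounded: `p ^ m A = 0`. -/
def IsPowBounded (p : R) (m : ℕ) (A : Submodule R M) : Prop :=
  ∀ a ∈ A, p ^ m • a = 0

/-- `h` is the height exponent of `a`: the largest `n` with `a ∈ p ^ n M`. -/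
def IsHeight (p : R) (a : M) (h : ℕ) : Prop :=
  IsGreatest {n : ℕ | ∃ b : M, a = p ^ n • b} h

/-- `l` is the height sequence of `a`: the finite sequence of the height exponents of the nonzero
elements among `a, p a, p² a, …`. -/
structure IsHeightSequence (p : R) (a : M) (l : List ℕ) : Prop where
  pow_length_smul_eq_zero : p ^ l.length • a = 0
  pow_smul_ne_zero : ∀ i < l.length, p ^ i • a ≠ 0
  isHeight : ∀ (i : ℕ) (hi : i < l.length), IsHeight p (p ^ i • a) l[i]

/-- `Q` is a power `P ^ k`, `k ≥ 1`, of a prime ideal `P` (the zero ideal of a domain is prime). -/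
def IsPrimeIdealPower (Q : Ideal R) : Prop :=
  ∃ P : Ideal R, P.IsPrime ∧ ∃ k : ℕ, 1 ≤ k ∧ Q = P ^ k

end SubmodulePair

open SubmodulePair

universe u v w

/-!
A nonzero `A` with `p ^ 2 A = 0` splits off a standard summand. Let `i ≤ 1` be maximal with
`p ^ i A ≠ 0`. Among the `a ∈ A` with `p ^ i a ≠ 0`, choose one for which first the height `k` of
`p ^ i a` and then the height `h` of `a` is maximal. By maximality, some functional
`f : A → Λ / p ^ (i + 1)` sends `a` to `1` and vanishes on `A ∩ p ^ (k + 1) B` and on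
`p ^ i (A ∩ p ^ (h + 1) B)`. As `Λ / r` is self-injective for `r ≠ 0`, this vanishing is what is
needed to extend `f` to a map from `(B; A)` to a standard pair `(M; m Λ)`, a picket or bipicket in
the terminology of Schmidmeier, with `a ↦ m`. Conversely the heights of `a` and `p ^ i a` yield a
map `M → B` with `m ↦ a`. The composition `M → B → M` fixes `m`, and endomorphisms of `M` fixing
`m` are automorphisms because they are injective on the socle. So `(M; m Λ)` is a direct summand of
`(B; A)`, hence all of it when `(B; A)` is indecomposable, and `i`, `h`, `k` are read off the height
sequence.

The pair `(M; m Λ)` is itself indecomposable: in a decomposition of `m Λ`, which is uniserial, `m`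
lies in one of the two summands, and the projection of `M` onto that summand fixes `m`.
-/

namespace SubmodulePair

open scoped Pointwise

section CyclicQuotient

variable {R : Type*} [CommRing R] {M : Type*} [AddCommGroup M] [Module R M]
  {N : Type*} [AddCommGroup N] [Module R N]

theorem mem_smul_top_iff_exists {r : R} {x : M} :
    x ∈ r • (⊤ : Submodule R M) ↔ ∃ y, x = r • y := by
  simp [Submodule.mem_smul_pointwise_iff_exists, eq_comm]

theorem exists_smul_one_eq (I : Ideal R) (x : R ⧸ I) : ∃ s : R, s • (1 : R ⧸ I) = x := by
  obtain ⟨s, rfl⟩ := Ideal.Quotient.mk_surjective x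
  exact ⟨s, by rw [Algebra.smul_def, mul_one, Ideal.Quotient.algebraMap_eq]⟩

theorem smul_one_eq_zero_iff {r s : R} : s • (1 : R ⧸ Ideal.span {r}) = 0 ↔ r ∣ s := by
  rw [Algebra.smul_def, mul_one, Ideal.Quotient.algebraMap_eq, Ideal.Quotient.eq_zero_iff_mem,
    Ideal.mem_span_singleton]

theorem smul_quotient_eq_zero {r s : R} (h : r ∣ s) (x : R ⧸ Ideal.span {r}) : s • x = 0 := by
  obtain ⟨t, rfl⟩ := exists_smul_one_eq _ x
  rw [smul_comm, smul_one_eq_zero_iff.2 h, smul_zero]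

theorem exists_linearMap_one_eq {r : R} {x : N} (hx : r • x = 0) :
    ∃ f : (R ⧸ Ideal.span {r}) →ₗ[R] N, f 1 = x :=
  ⟨Submodule.liftQSpanSingleton r (LinearMap.toSpanSingleton R N x) hx,
    (Submodule.liftQSpanSingleton_apply _ _ _ _).trans (one_smul R x)⟩

theorem exists_eq_smul_of_smul_eq_zero [IsDomain R] {r s t : R} (hr : r = s * t) (hs : s ≠ 0)
    {x : R ⧸ Ideal.span {r}} (hx : s • x = 0) : ∃ y, x = t • y := by
  obtain ⟨c, rfl⟩ := exists_smul_one_eq _ x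
  rw [smul_smul, smul_one_eq_zero_iff, hr, mul_dvd_mul_iff_left hs] at hx
  obtain ⟨d, rfl⟩ := hx
  exact ⟨d • 1, mul_smul t d 1⟩

end CyclicQuotient

section SelfInjective

variable {Λ : Type*} [CommRing Λ] [IsDomain Λ] [IsPrincipalIdealRing Λ]
  {B : Type*} [AddCommGroup B] [Module Λ B] {C : Type*} [AddCommGroup C] [Module Λ C]

theorem baer_quotient_span_singleton {r : Λ} (hr : r ≠ 0) :
    Module.Baer (Λ ⧸ Ideal.span {r}) (Λ ⧸ Ideal.span {r}) := by
  intro I g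
  obtain ⟨s, hs⟩ := IsPrincipalIdealRing.principal (I.comap (Ideal.Quotient.mk (Ideal.span {r})))
  replace hs : ∀ x, Ideal.Quotient.mk (Ideal.span {r}) x ∈ I ↔ s ∣ x := fun x ↦ by
    rw [← Ideal.mem_comap, hs]
    exact Ideal.mem_span_singleton
  obtain ⟨t, rfl⟩ : s ∣ r := (hs r).1 (by simp)
  let σ : I := ⟨Ideal.Quotient.mk _ s, (hs s).2 dvd_rfl⟩
  have htσ : t • g σ = 0 := by
    have h0 : t • σ = 0 := Subtype.ext (Ideal.Quotient.eq_zero_iff_mem.2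
      (Ideal.mem_span_singleton.2 (mul_comm s t).dvd))
    rw [← g.map_smul_of_tower, h0, map_zero]
  obtain ⟨z, hz⟩ := exists_eq_smul_of_smul_eq_zero (mul_comm s t) (right_ne_zero_of_mul hr) htσ
  refine ⟨LinearMap.toSpanSingleton _ _ z, fun x hx ↦ ?_⟩
  obtain ⟨x, rfl⟩ := Ideal.Quotient.mk_surjective x
  obtain ⟨u, rfl⟩ := (hs x).1 hx
  have huσ : u • σ = ⟨_, hx⟩ :=
    Subtype.ext (congrArg (Ideal.Quotient.mk (Ideal.span {s * t})) (mul_comm u s))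
  calc Ideal.Quotient.mk (Ideal.span {s * t}) (s * u) • z = u • s • z := by
        rw [smul_smul, mul_comm s u]
        rfl
    _ = u • g σ := by rw [hz]
    _ = g (u • σ) := (g.map_smul_of_tower u σ).symm
    _ = g ⟨_, hx⟩ := by rw [huσ]

theorem exists_linearMap_comp_eq_of_isTorsionBy {r : Λ} (hr : r ≠ 0) (hB : Module.IsTorsionBy Λ B r)
    {j : C →ₗ[Λ] B} (hj : Function.Injective j) (g : C →ₗ[Λ] Λ ⧸ Ideal.span {r}) :
    ∃ φ : B →ₗ[Λ] Λ ⧸ Ideal.span {r}, φ ∘ₗ j = g := by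
  have hC : Module.IsTorsionBy Λ C r := fun x ↦ hj (by rw [map_smul, hB, map_zero])
  let := hB.module
  let := hC.module
  have hsurj : Function.Surjective (algebraMap Λ (Λ ⧸ Ideal.span {r})) :=
    Ideal.Quotient.mk_surjective
  have : IsScalarTower Λ (Λ ⧸ Ideal.span {r}) B :=
    ((Module.isTorsionBySet_span_singleton_iff r).2 hB).isScalarTower
  have : IsScalarTower Λ (Λ ⧸ Ideal.span {r}) C :=
    ((Module.isTorsionBySet_span_singleton_iff r).2 hC).isScalarTower
  obtain ⟨φ, hφ⟩ := (baer_quotient_span_singleton hr).extension_property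
    (j.extendScalarsOfSurjective hsurj) hj (g.extendScalarsOfSurjective hsurj)
  exact ⟨φ.restrictScalars Λ, LinearMap.ext fun x ↦ LinearMap.congr_fun hφ x⟩

theorem exists_linearMap_comp_eq {r : Λ} (hr : r ≠ 0) (j : C →ₗ[Λ] B)
    (g : C →ₗ[Λ] Λ ⧸ Ideal.span {r}) (h : ∀ x, j x ∈ r • (⊤ : Submodule Λ B) → g x = 0) :
    ∃ φ : B →ₗ[Λ] Λ ⧸ Ideal.span {r}, φ ∘ₗ j = g := by
  let P : Submodule Λ B := r • ⊤
  have hker : Function.Injective ((P.comap j).mapQ P j le_rfl) := by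
    rw [← LinearMap.ker_eq_bot, Submodule.ker_mapQ, Submodule.mkQ_map_self]
  obtain ⟨φ, hφ⟩ := exists_linearMap_comp_eq_of_isTorsionBy hr
    (Module.isTorsionBy_quotient_element_smul B r) hker ((P.comap j).liftQ g h)
  exact ⟨φ ∘ₗ P.mkQ, LinearMap.ext fun x ↦ LinearMap.congr_fun hφ ((P.comap j).mkQ x)⟩

theorem torsionOf_eq_span_pow {p : Λ} (hp : Prime p) {n : ℕ} {x : B} (h : p ^ (n + 1) • x = 0)
    (h' : p ^ n • x ≠ 0) : Ideal.torsionOf Λ B x = Ideal.span {p ^ (n + 1)} := by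
  obtain ⟨d, hd⟩ := IsPrincipalIdealRing.principal (Ideal.torsionOf Λ B x)
  rw [Ideal.submodule_span_eq] at hd
  have hdvd (s : Λ) : s • x = 0 ↔ d ∣ s := by
    rw [← Ideal.mem_torsionOf_iff, hd, Ideal.mem_span_singleton]
  obtain ⟨m, hm, hdm⟩ := (dvd_prime_pow hp _).1 ((hdvd _).1 h)
  have hnm : n < m := by
    by_contra! hle
    exact h' ((hdvd _).2 (hdm.dvd.trans (pow_dvd_pow p hle)))
  rw [hd, Ideal.span_singleton_eq_span_singleton.2 hdm, le_antisymm hm hnm]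

theorem exists_linearMap_apply_eq_one {p : Λ} (hp : Prime p) {i : ℕ}
    (hB : ∀ b : B, p ^ (i + 1) • b = 0) {K : Submodule Λ B} {a : B} (ha : p ^ i • a ∉ K) :
    ∃ f : B →ₗ[Λ] Λ ⧸ Ideal.span {p ^ (i + 1)}, f a = 1 ∧ K ≤ LinearMap.ker f := by
  have htop : p ^ (i + 1) • (⊤ : Submodule Λ (B ⧸ K)) = ⊥ := by
    rw [eq_bot_iff]
    rintro x hx
    obtain ⟨y, rfl⟩ := mem_smul_top_iff_exists.1 hx
    obtain ⟨b, rfl⟩ := K.mkQ_surjective y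
    rw [← map_smul, hB, map_zero]
    exact Submodule.zero_mem _
  have htors : Ideal.torsionOf Λ (B ⧸ K) (K.mkQ a) = Ideal.span {p ^ (i + 1)} := by
    refine torsionOf_eq_span_pow hp (by rw [← map_smul, hB, map_zero]) ?_
    rwa [← map_smul, Ne, Submodule.mkQ_apply, Submodule.Quotient.mk_eq_zero]
  obtain ⟨φ, hφ⟩ := exists_linearMap_comp_eq (pow_ne_zero (i + 1) hp.ne_zero)
    (LinearMap.toSpanSingleton Λ _ (K.mkQ a)) (Ideal.span {p ^ (i + 1)}).mkQ fun s hs ↦ by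
      rw [htop, Submodule.mem_bot, LinearMap.toSpanSingleton_apply, ← Ideal.mem_torsionOf_iff,
        htors] at hs
      exact (Submodule.Quotient.mk_eq_zero _).2 hs
  refine ⟨φ ∘ₗ K.mkQ, ?_, (K.ker_mkQ.ge.trans (LinearMap.ker_le_ker_comp _ _))⟩
  simpa using LinearMap.congr_fun hφ 1

end SelfInjective

section Pairs

variable {R : Type*} [CommRing R] {M : Type*} [AddCommGroup M] [Module R M]
  {N : Type*} [AddCommGroup N] [Module R N] {L : Type*} [AddCommGroup L] [Module R L]

theorem PairIso.symm {A : Submodule R M} {C : Submodule R N} (h : PairIso A C) : PairIso C A := by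
  obtain ⟨e, rfl⟩ := h
  exact ⟨e.symm, by rw [← Submodule.map_comp, LinearEquiv.symm_comp, Submodule.map_id]⟩

theorem PairIso.trans {A : Submodule R M} {C : Submodule R N} {D : Submodule R L}
    (h : PairIso A C) (h' : PairIso C D) : PairIso A D := by
  obtain ⟨e, rfl⟩ := h
  obtain ⟨e', rfl⟩ := h'
  exact ⟨e.trans e', by rw [← Submodule.map_comp, LinearEquiv.coe_trans]⟩

theorem PairIso.eq_bot_iff {A : Submodule R M} {C : Submodule R N} (h : PairIso A C) :
    A = ⊥ ↔ C = ⊥ := by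
  obtain ⟨e, rfl⟩ := h
  exact Submodule.map_eq_bot_iff.symm

theorem IsIndecomposablePair.eq_zero_or_eq_one {A : Submodule R M} (hA : IsIndecomposablePair A)
    {e : Module.End R M} (he : IsIdempotentElem e) (heA : A ≤ A.comap e) : e = 0 ∨ e = 1 := by
  have hsplit : A = A ⊓ LinearMap.range e ⊔ A ⊓ LinearMap.ker e := by
    refine le_antisymm (fun x hx ↦ Submodule.mem_sup.2 ?_) (sup_le inf_le_left inf_le_left)
    refine ⟨e x, ⟨heA hx, x, rfl⟩, x - e x, ⟨A.sub_mem hx (heA hx), ?_⟩, add_sub_cancel _ _⟩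
    rw [SetLike.mem_coe, LinearMap.mem_ker, map_sub, ← Module.End.mul_apply, he.eq, sub_self]
  refine (hA.2 _ _ _ _ (LinearMap.IsIdempotentElem.isCompl he) inf_le_right inf_le_right
    hsplit).imp LinearMap.range_eq_bot.1 fun hker ↦ LinearMap.ext fun x ↦ ?_
  exact LinearMap.ker_eq_bot.1 hker (LinearMap.congr_fun he.eq x)

theorem IsIndecomposablePair.pairIso_of_retract {A : Submodule R N} (hA : IsIndecomposablePair A)
    [Nontrivial M] {C : Submodule R M} {φ : N →ₗ[R] M} {ψ : M →ₗ[R] N}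
    (hφψ : φ ∘ₗ ψ = LinearMap.id) (hψ : C ≤ A.comap ψ) (hφ : A ≤ C.comap φ) : PairIso C A := by
  have hφψ' (x : M) : φ (ψ x) = x := LinearMap.congr_fun hφψ x
  have hidem : IsIdempotentElem (ψ ∘ₗ φ) := LinearMap.ext fun x ↦ congrArg ψ (hφψ' (φ x))
  have hψφ : ψ ∘ₗ φ = LinearMap.id := by
    refine (hA.eq_zero_or_eq_one hidem fun x hx ↦ hψ (hφ hx)).resolve_left fun h0 ↦ ?_
    obtain ⟨x, hx⟩ := exists_ne (0 : M)
    have := LinearMap.congr_fun h0 (ψ x)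
    rw [LinearMap.comp_apply, hφψ', LinearMap.zero_apply] at this
    exact hx (by rw [← hφψ' x, this, map_zero])
  refine ⟨LinearEquiv.ofLinearMap ψ φ hψφ hφψ, le_antisymm (Submodule.map_le_iff_le_comap.2 hψ) ?_⟩
  exact fun x hx ↦ ⟨φ x, hφ hx, LinearMap.congr_fun hψφ x⟩

/-- Every endomorphism of `M` fixing `m` is an automorphism, that is, `r ↦ r • m` is a left minimal
morphism `R → M` in the sense of Auslander and Reiten. -/
def IsLeftMinimal (R : Type*) [CommRing R] {M : Type*} [AddCommGroup M] [Module R M] (m : M) :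
    Prop :=
  ∀ θ : M →ₗ[R] M, θ m = m → Function.Bijective θ

theorem IsIndecomposablePair.pairIso_span_of_isLeftMinimal {A : Submodule R N}
    (hA : IsIndecomposablePair A) {m : M} (hm : m ≠ 0) (hmin : IsLeftMinimal R m)
    {φ : N →ₗ[R] M} {ψ : M →ₗ[R] N} (hψ : ψ m ∈ A) (hφψ : φ (ψ m) = m)
    (hφ : A ≤ (Submodule.span R {m}).comap φ) : PairIso (Submodule.span R {m}) A := by
  let θ : M ≃ₗ[R] M := LinearEquiv.ofBijective (φ ∘ₗ ψ) (hmin _ hφψ)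
  have hθm : θ.symm m = m := θ.symm_apply_eq.2 hφψ.symm
  have : Nontrivial M := ⟨m, 0, hm⟩
  refine hA.pairIso_of_retract (φ := φ) (ψ := ψ ∘ₗ θ.symm) (LinearMap.ext θ.apply_symm_apply) ?_ hφ
  rw [Submodule.span_singleton_le_iff_mem, Submodule.mem_comap, LinearMap.comp_apply,
    LinearEquiv.coe_coe, hθm]
  exact hψ

theorem IsLeftMinimal.eq_bot_of_isCompl {m : M} (hmin : IsLeftMinimal R m) {M₁ M₂ : Submodule R M}
    (hc : IsCompl M₁ M₂) (hm : m ∈ M₁) : M₂ = ⊥ := by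
  have hinj := (hmin (M₁.projection M₂ hc) (Submodule.projection_apply_of_mem_left hc hm)).injective
  rw [← Submodule.ker_projection hc, LinearMap.ker_eq_bot.2 hinj]

theorem eq_bot_or_eq_bot_of_infIrred_torsionOf {m : M} (hm : InfIrred (Ideal.torsionOf R M m))
    {A₁ A₂ : Submodule R M} (hd : Disjoint A₁ A₂) (h₁ : A₁ ≤ Submodule.span R {m})
    (h₂ : A₂ ≤ Submodule.span R {m}) : A₁ = ⊥ ∨ A₂ = ⊥ := by
  let f := LinearMap.toSpanSingleton R M m
  have hf {A : Submodule R M} (hA : A ≤ Submodule.span R {m})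
      (h : A.comap f = Ideal.torsionOf R M m) : A = ⊥ := by
    rw [← Submodule.map_comap_eq_of_le (f := f) (p := A) (by rwa [LinearMap.range_toSpanSingleton]),
      h]
    exact LinearMap.le_ker_iff_map.1 le_rfl
  refine (hm.2 ?_).imp (hf h₁) (hf h₂)
  rw [← Submodule.comap_inf, hd.eq_bot]
  rfl

theorem IsLeftMinimal.isIndecomposablePair {m : M} (hmin : IsLeftMinimal R m) (hm : m ≠ 0)
    (hirr : InfIrred (Ideal.torsionOf R M m)) :
    IsIndecomposablePair (Submodule.span R {m}) := by
  refine ⟨⟨m, 0, hm⟩, fun M₁ M₂ A₁ A₂ hc h₁ h₂ hA ↦ ?_⟩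
  have hmem : m ∈ A₁ ⊔ A₂ := hA ▸ Submodule.mem_span_singleton_self m
  rcases eq_bot_or_eq_bot_of_infIrred_torsionOf hirr (hc.disjoint.mono h₁ h₂)
    (le_sup_left.trans hA.ge) (le_sup_right.trans hA.ge) with rfl | rfl
  · exact .inl (hmin.eq_bot_of_isCompl hc.symm (h₂ (by rwa [bot_sup_eq] at hmem)))
  · exact .inr (hmin.eq_bot_of_isCompl hc (h₁ (by rwa [sup_bot_eq] at hmem)))

theorem isIndecomposablePair_bot_quotient_of_infIrred {Q : Ideal R} (hQ : InfIrred Q) :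
    IsIndecomposablePair (⊥ : Submodule R (R ⧸ Q)) := by
  have htors : Ideal.torsionOf R (R ⧸ Q) 1 = Q := by
    ext s
    rw [Ideal.mem_torsionOf_iff, Algebra.smul_def, mul_one, Ideal.Quotient.algebraMap_eq,
      Ideal.Quotient.eq_zero_iff_mem]
  have hspan (A : Submodule R (R ⧸ Q)) : A ≤ Submodule.span R {1} := fun x _ ↦
    Submodule.mem_span_singleton.2 (exists_smul_one_eq Q x)
  refine ⟨Ideal.Quotient.nontrivial_iff.2 hQ.ne_top, fun M₁ M₂ _ _ hc _ _ _ ↦ ?_⟩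
  exact eq_bot_or_eq_bot_of_infIrred_torsionOf (htors.symm ▸ hQ) hc.disjoint (hspan _) (hspan _)

theorem isPrimeIdealPower_bot [IsDomain R] : IsPrimeIdealPower (⊥ : Ideal R) :=
  ⟨⊥, Ideal.isPrime_bot, 1, le_rfl, (pow_one _).symm⟩

theorem isPrimeIdealPower_span_pow {p : R} (hp : Prime p) {k : ℕ} (hk : k ≠ 0) :
    IsPrimeIdealPower (Ideal.span {p ^ k}) :=
  ⟨Ideal.span {p}, (Ideal.span_singleton_prime hp.ne_zero).2 hp, k, Nat.one_le_iff_ne_zero.2 hk,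
    (Ideal.span_singleton_pow p k).symm⟩

theorem IsPrimeIdealPower.infIrred [IsDedekindDomain R] {Q : Ideal R} (hQ : IsPrimeIdealPower Q) :
    InfIrred Q := by
  obtain ⟨P, hP, k, hk, rfl⟩ := hQ
  refine ⟨fun hmax ↦ ?_, fun I J hIJ ↦ ?_⟩
  · exact hP.ne_top (top_le_iff.1 (hmax.eq_top.ge.trans (Ideal.pow_le_self (by omega))))
  by_cases hP0 : P = ⊥
  · have hPk : P ^ k = P := by
      rw [hP0]
      exact zero_pow (by omega)
    rw [hPk] at hIJ ⊢
    exact (hP.inf_le.1 hIJ.le).imp (fun h ↦ h.antisymm (hIJ ▸ inf_le_left))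
      fun h ↦ h.antisymm (hIJ ▸ inf_le_right)
  · have hpow {I : Ideal R} (hI : P ^ k ≤ I) : ∃ i, I = P ^ i := by
      obtain ⟨i, -, hi⟩ :=
        (dvd_prime_pow (Ideal.prime_of_isPrime hP0 hP) k).1 (Ideal.dvd_iff_le.2 hI)
      exact ⟨i, associated_iff_eq.1 hi⟩
    obtain ⟨i, rfl⟩ := hpow (hIJ ▸ inf_le_left)
    obtain ⟨j, rfl⟩ := hpow (hIJ ▸ inf_le_right)
    rw [← hIJ]
    rcases le_total i j with h | h
    · exact .inr (inf_eq_right.2 (Ideal.pow_le_pow_right h)).symm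
    · exact .inl (inf_eq_left.2 (Ideal.pow_le_pow_right h)).symm

end Pairs

section Heights

variable {R : Type*} [CommRing R] {M : Type*} [AddCommGroup M] [Module R M]
  {N : Type*} [AddCommGroup N] [Module R N] {p : R}

theorem pow_smul_top_antitone (p : R) : Antitone fun n : ℕ ↦ p ^ n • (⊤ : Submodule R M) := by
  intro m n hmn x hx
  obtain ⟨y, rfl⟩ := mem_smul_top_iff_exists.1 hx
  exact mem_smul_top_iff_exists.2 ⟨p ^ (n - m) • y, by rw [smul_smul, pow_mul_pow_sub p hmn]⟩

theorem isHeight_iff {x : M} {h : ℕ} :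
    IsHeight p x h ↔ x ∈ p ^ h • (⊤ : Submodule R M) ∧ x ∉ p ^ (h + 1) • (⊤ : Submodule R M) := by
  simp only [mem_smul_top_iff_exists]
  refine ⟨fun H ↦ ⟨H.1, fun hx ↦ absurd (H.2 hx) (by omega)⟩, fun H ↦ ⟨H.1, fun n hn ↦ ?_⟩⟩
  by_contra! hlt
  exact H.2 (mem_smul_top_iff_exists.1
    (pow_smul_top_antitone p hlt (mem_smul_top_iff_exists.2 hn)))

theorem IsHeight.ne_zero {x : M} {h : ℕ} (hx : IsHeight p x h) : x ≠ 0 := by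
  rintro rfl
  exact (isHeight_iff.1 hx).2 (Submodule.zero_mem _)

theorem IsHeight.of_linearMap {x : M} {y : N} {h : ℕ} (hx : IsHeight p x h) {f : M →ₗ[R] N}
    {g : N →ₗ[R] M} (hf : f x = y) (hg : g y = x) : IsHeight p y h := by
  refine ⟨?_, fun n ⟨b, hb⟩ ↦ hx.2 ⟨g b, by rw [← map_smul, ← hb, hg]⟩⟩
  obtain ⟨b, hb⟩ := hx.1
  exact ⟨f b, by rw [← map_smul, ← hb, hf]⟩

theorem IsHeightSequence.ne_nil {x : M} {l : List ℕ} (h : IsHeightSequence p x l) (hx : x ≠ 0) :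
    l ≠ [] := by
  rintro rfl
  exact hx (by simpa using h.pow_length_smul_eq_zero)

theorem IsHeightSequence.pairwise_lt {x : M} {l : List ℕ} (h : IsHeightSequence p x l) :
    l.Pairwise (· < ·) := by
  rw [← List.isChain_iff_pairwise, List.isChain_iff_getElem]
  intro i hi
  obtain ⟨b, hb⟩ := (h.isHeight i (by omega)).1
  exact (h.isHeight (i + 1) hi).2 ⟨b, by rw [pow_succ', mul_smul, hb, smul_smul, ← pow_succ']⟩

theorem IsHeightSequence.unique {x : M} {l l' : List ℕ} (h : IsHeightSequence p x l)
    (h' : IsHeightSequence p x l') : l = l' := by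
  have hlen : l.length = l'.length := by
    refine le_antisymm ?_ ?_ <;> by_contra! hlt
    · exact h.pow_smul_ne_zero _ hlt h'.pow_length_smul_eq_zero
    · exact h'.pow_smul_ne_zero _ hlt h.pow_length_smul_eq_zero
  exact List.ext_getElem hlen fun i hi hi' ↦ (h.isHeight i hi).unique (h'.isHeight i hi')

theorem IsHeightSequence.of_linearMap {x : M} {y : N} {l : List ℕ} (h : IsHeightSequence p x l)
    {f : M →ₗ[R] N} {g : N →ₗ[R] M} (hf : f x = y) (hg : g y = x) : IsHeightSequence p y l where
  pow_length_smul_eq_zero := by rw [← hf, ← map_smul, h.pow_length_smul_eq_zero, map_zero]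
  pow_smul_ne_zero i hi h0 := h.pow_smul_ne_zero i hi (by rw [← hg, ← map_smul, h0, map_zero])
  isHeight i hi := (h.isHeight i hi).of_linearMap (f := f) (g := g) (by rw [map_smul, hf])
    (by rw [map_smul, hg])

theorem PairIso.exists_linearMap_of_span {x : M} {y : N}
    (h : PairIso (Submodule.span R {x}) (Submodule.span R {y})) :
    ∃ (f : M →ₗ[R] N) (g : N →ₗ[R] M), f x = y ∧ g y = x := by
  obtain ⟨e, he⟩ := h
  rw [Submodule.map_span, Set.image_singleton, LinearEquiv.coe_coe] at he
  obtain ⟨r, hr⟩ := Submodule.mem_span_singleton.1 (he ▸ Submodule.mem_span_singleton_self y)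
  obtain ⟨s, hs⟩ := Submodule.mem_span_singleton.1 (he ▸ Submodule.mem_span_singleton_self (e x))
  refine ⟨r • e.toLinearMap, s • e.symm.toLinearMap, hr, ?_⟩
  rw [LinearMap.smul_apply, ← map_smul, hs, LinearEquiv.coe_coe, e.symm_apply_apply]

theorem IsHeightSequence.of_pairIso {x : M} {y : N} {l : List ℕ} (h : IsHeightSequence p x l)
    (hxy : PairIso (Submodule.span R {x}) (Submodule.span R {y})) : IsHeightSequence p y l := by
  obtain ⟨f, g, hf, hg⟩ := hxy.exists_linearMap_of_span
  exact h.of_linearMap hf hg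

theorem isHeightSequence_singleton {x : M} {h : ℕ} (h0 : x ≠ 0) (h1 : p • x = 0)
    (hx : IsHeight p x h) : IsHeightSequence p x [h] where
  pow_length_smul_eq_zero := by simpa using h1
  pow_smul_ne_zero i hi := by
    obtain rfl : i = 0 := by simpa using hi
    simpa using h0
  isHeight i hi := by
    obtain rfl : i = 0 := by simpa using hi
    simpa using hx

theorem isHeightSequence_pair {x : M} {h k : ℕ} (h0 : p • x ≠ 0) (h1 : p ^ 2 • x = 0)
    (hx : IsHeight p x h) (hpx : IsHeight p (p • x) k) : IsHeightSequence p x [h, k] where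
  pow_length_smul_eq_zero := h1
  pow_smul_ne_zero i hi hi0 := by
    obtain rfl | rfl : i = 0 ∨ i = 1 :=
      Nat.le_one_iff_eq_zero_or_eq_one.1 (Nat.lt_succ_iff.1 hi)
    · rw [pow_zero, one_smul] at hi0
      exact h0 (by rw [hi0, smul_zero])
    · exact h0 (by rwa [pow_one] at hi0)
  isHeight i hi := by
    obtain rfl | rfl : i = 0 ∨ i = 1 :=
      Nat.le_one_iff_eq_zero_or_eq_one.1 (Nat.lt_succ_iff.1 hi)
    · simpa using hx
    · simpa using hpx

section Noetherian

variable [IsNoetherianRing R] [Module.Finite R M] {A : Submodule R M} {m : ℕ}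

theorem IsPowBounded.exists_forall_lt (hA : IsPowBounded p m A) :
    ∃ n : ℕ, ∀ x ∈ A, x ≠ 0 → ∀ j, x ∈ p ^ j • (⊤ : Submodule R M) → j < n := by
  obtain ⟨k, hk⟩ := Ideal.exists_pow_inf_eq_pow_smul (Ideal.span {p}) A
  simp only [Ideal.span_singleton_pow, Submodule.ideal_span_singleton_smul] at hk
  refine ⟨k + m, fun x hx hx0 j hj ↦ ?_⟩
  by_contra! hle
  have hmem : x ∈ p ^ (k + m) • (⊤ : Submodule R M) ⊓ A := ⟨pow_smul_top_antitone p hle hj, hx⟩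
  rw [hk _ (Nat.le_add_right k m), Nat.add_sub_cancel_left] at hmem
  obtain ⟨y, hy, rfl⟩ := hmem
  exact hx0 (hA y hy.2)

theorem IsPowBounded.exists_isHeight (hA : IsPowBounded p m A) {x : M} (hx : x ∈ A) (hx0 : x ≠ 0) :
    ∃ h, IsHeight p x h := by
  obtain ⟨n, hn⟩ := hA.exists_forall_lt
  exact BddAbove.exists_isGreatest_of_nonempty
    ⟨n, fun j hj ↦ (hn x hx hx0 j (mem_smul_top_iff_exists.2 hj)).le⟩ ⟨0, x, by simp⟩

theorem IsPowBounded.exists_isHeightSequence {a : M}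
    (hA : IsPowBounded p m (Submodule.span R {a})) :
    ∃ l : List ℕ, l.length ≤ m ∧ IsHeightSequence p a l := by
  classical
  have ha : a ∈ Submodule.span R {a} := Submodule.mem_span_singleton_self a
  have hex : ∃ n, p ^ n • a = 0 := ⟨m, hA a ha⟩
  have hheight (i : Fin (Nat.find hex)) : ∃ h, IsHeight p (p ^ (i : ℕ) • a) h :=
    hA.exists_isHeight (Submodule.smul_mem _ _ ha) (Nat.find_min hex i.2)
  choose f hf using hheight
  refine ⟨List.ofFn f, by simpa using ⟨m, le_rfl, hA a ha⟩, ?_, fun i hi ↦ ?_, fun i hi ↦ ?_⟩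
  · simpa using Nat.find_spec hex
  · exact Nat.find_min hex (by simpa using hi)
  · simpa using hf ⟨i, by simpa using hi⟩

theorem IsPowBounded.exists_pow_smul_notMem {i : ℕ} (hA : IsPowBounded p (i + 1) A)
    (hi : ¬ IsPowBounded p i A) :
    ∃ a ∈ A, ∃ h k, IsHeight p a h ∧ IsHeight p (p ^ i • a) k ∧
      p ^ i • a ∉ A ⊓ p ^ (k + 1) • ⊤ ⊔ p ^ i • (A ⊓ p ^ (h + 1) • ⊤) := by
  obtain ⟨n, hn⟩ := hA.exists_forall_lt
  obtain ⟨x, hx, hx0⟩ : ∃ x ∈ A, p ^ i • x ≠ 0 := by simpa [IsPowBounded] using hi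
  obtain ⟨k, ⟨y, hy, hy0, hyk⟩, hkmax⟩ := BddAbove.exists_isGreatest_of_nonempty
    (S := {j | ∃ x ∈ A, p ^ i • x ≠ 0 ∧ p ^ i • x ∈ p ^ j • (⊤ : Submodule R M)})
    ⟨n, fun j ⟨x, hx, hx0, hj⟩ ↦ (hn _ (A.smul_mem _ hx) hx0 j hj).le⟩ ⟨0, x, hx, hx0, by simp⟩
  obtain ⟨h, ⟨a, ha, ha0, hak, hah⟩, hhmax⟩ := BddAbove.exists_isGreatest_of_nonempty
    (S := {j | ∃ x ∈ A, p ^ i • x ≠ 0 ∧ p ^ i • x ∈ p ^ k • (⊤ : Submodule R M) ∧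
      x ∈ p ^ j • (⊤ : Submodule R M)})
    ⟨n, fun j ⟨x, hx, hx0, _, hj⟩ ↦ (hn x hx (by rintro rfl; simp at hx0) j hj).le⟩
    ⟨0, y, hy, hy0, hyk, by simp⟩
  refine ⟨a, ha, h, k, isHeight_iff.2 ⟨hah, fun hah' ↦ ?_⟩, isHeight_iff.2 ⟨hak, fun hak' ↦ ?_⟩,
    fun hmem ↦ ?_⟩
  · exact (hhmax ⟨a, ha, ha0, hak, hah'⟩).not_gt h.lt_succ_self
  · exact (hkmax ⟨a, ha, ha0, hak'⟩).not_gt k.lt_succ_self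
  · obtain ⟨c, ⟨-, hck⟩, _, ⟨d, ⟨hd, hdh⟩, rfl⟩, hsum⟩ := Submodule.mem_sup.1 hmem
    replace hsum : c + p ^ i • d = p ^ i • a := hsum
    have hcad : p ^ i • (a - d) = c := by rw [smul_sub, ← hsum, add_sub_cancel_right]
    by_cases hc0 : c = 0
    · rw [hc0, zero_add] at hsum
      exact (hhmax ⟨d, hd, hsum ▸ ha0, hsum ▸ hak, hdh⟩).not_gt h.lt_succ_self
    · exact (hkmax ⟨a - d, A.sub_mem ha hd, hcad ▸ hc0, hcad ▸ hck⟩).not_gt k.lt_succ_self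

end Noetherian

end Heights

section StandardPairs

/-- The parameters of the indecomposable pairs generated by one element `a` of order `p ^ (i + 1)`:
`h` and `k` are the heights of `a` and `p ^ i • a`, and the ambient module is
`Λ / p ^ (k + 1) × Λ / p ^ n`. It is cyclic, encoded as `n = 0`, for pickets; bipickets occur when
the heights of `a` and `p • a` have a gap. -/
inductive IsStandardType : (i h k n : ℕ) → Prop
  | picket {i h : ℕ} (hi : i ≤ 1) : IsStandardType i h (h + i) 0
  | bipicket {h k : ℕ} (hk : h + 1 < k) : IsStandardType 1 h k (h + 1)

/-- The ambient module of the standard pair of type `(i, h, k, n)`; its submodule is generated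
by `standardGenerator p i h k n`. -/
abbrev StandardModule {Λ : Type*} [CommRing Λ] (p : Λ) (k n : ℕ) : Type _ :=
  (Λ ⧸ Ideal.span {p ^ (k + 1)}) × (Λ ⧸ Ideal.span {p ^ n})

/-- The generator of the submodule of the standard pair of type `(i, h, k, n)`. Its second component
is `0` for pickets, and the first one has height `h` for pickets but `k - 1 > h` for bipickets. -/
def standardGenerator {Λ : Type*} [CommRing Λ] (p : Λ) (i h k n : ℕ) : StandardModule p k n :=
  (p ^ (k - i) • 1, p ^ h • 1)

theorem exists_isStandardType {i h k : ℕ} (hi : i ≤ 1) (hle : h + i ≤ k) (h0 : i = 0 → k = h) :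
    ∃ n, IsStandardType i h k n := by
  rcases hle.eq_or_lt with rfl | hlt
  · exact ⟨0, .picket hi⟩
  · obtain rfl : i = 1 := by omega
    exact ⟨h + 1, .bipicket hlt⟩

theorem exists_isStandardType_take_eq {l : List ℕ} (hne : l ≠ []) (hl : l.Pairwise (· < ·))
    (hlen : l.length ≤ 2) : ∃ i h k n, IsStandardType i h k n ∧ [h, k].take (i + 1) = l := by
  match l, hne, hl, hlen with
  | [h], _, _, _ => exact ⟨0, h, h, 0, .picket zero_le_one, rfl⟩
  | [h, k], _, hl, _ =>
    have hlt : h < k := by simpa using hl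
    obtain ⟨n, H⟩ := exists_isStandardType le_rfl hlt (by simp)
    exact ⟨1, h, k, n, H, rfl⟩

theorem IsStandardType.eq_of_take_eq {i h k n i' h' k' n' : ℕ} (H : IsStandardType i h k n)
    (H' : IsStandardType i' h' k' n') (heq : [h, k].take (i + 1) = [h', k'].take (i' + 1)) :
    i = i' ∧ h = h' ∧ k = k' ∧ n = n' := by
  have hi : i ≤ 1 := by cases H <;> omega
  have hi' : i' ≤ 1 := by cases H' <;> omega
  interval_cases i <;> interval_cases i' <;>
    simp only [List.take, List.cons.injEq, reduceCtorEq, and_true, and_false] at heq <;>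
    cases H <;> cases H' <;> omega

section CommRing

variable {Λ : Type*} [CommRing Λ] {p : Λ} {i h k n : ℕ} {N : Type*} [AddCommGroup N] [Module Λ N]

theorem mk_mem_smul_top_iff {M : Type*} [AddCommGroup M] [Module Λ M] {r : Λ} {x : M} {y : N} :
    (x, y) ∈ r • (⊤ : Submodule Λ (M × N)) ↔
      x ∈ r • (⊤ : Submodule Λ M) ∧ y ∈ r • (⊤ : Submodule Λ N) := by
  simp [mem_smul_top_iff_exists]

theorem injective_of_forall_smul_eq_zero {M : Type*} [AddCommGroup M] [Module Λ M]
    {f : M →ₗ[Λ] N} {m : ℕ} (hM : ∀ x : M, p ^ m • x = 0)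
    (hf : ∀ x, p • x = 0 → f x = 0 → x = 0) : Function.Injective f := by
  rw [injective_iff_map_eq_zero]
  intro x hx
  suffices ∀ j, p ^ j • x = 0 → x = 0 from this m (hM x)
  intro j
  induction j with
  | zero => simp
  | succ j ih =>
    intro hj
    exact ih (hf _ (by rwa [smul_smul, ← pow_succ']) (by rw [map_smul, hx, smul_zero]))

theorem subsingleton_quotient_span_pow_zero (p : Λ) : Subsingleton (Λ ⧸ Ideal.span {p ^ 0}) :=
  Ideal.Quotient.subsingleton_iff.2 (by rw [pow_zero, Ideal.span_singleton_one])

theorem IsStandardType.pow_smul_standardGenerator (H : IsStandardType i h k n) :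
    p ^ i • standardGenerator p i h k n = (p ^ k • 1, 0) := by
  have hsnd : p ^ i • p ^ h • (1 : Λ ⧸ Ideal.span {p ^ n}) = 0 := by
    rw [smul_smul, ← pow_add]
    exact smul_quotient_eq_zero (pow_dvd_pow p (by cases H <;> omega)) 1
  rw [standardGenerator, Prod.smul_mk, hsnd, smul_smul,
    pow_mul_pow_sub p (show i ≤ k by cases H <;> omega)]

theorem IsStandardType.pow_succ_smul_standardGenerator (H : IsStandardType i h k n) :
    p ^ (i + 1) • standardGenerator p i h k n = 0 := by
  rw [pow_succ' p i, mul_smul, H.pow_smul_standardGenerator, Prod.smul_mk, smul_zero, smul_smul,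
    ← pow_succ' p k, smul_quotient_eq_zero dvd_rfl, Prod.mk_zero_zero]

theorem IsStandardType.isPowBounded (H : IsStandardType i h k n) :
    IsPowBounded p 2 (Submodule.span Λ {standardGenerator p i h k n}) := by
  intro x hx
  obtain ⟨s, rfl⟩ := Submodule.mem_span_singleton.1 hx
  have hi : i + 1 ≤ 2 := by cases H <;> omega
  rw [smul_comm, ← pow_sub_mul_pow p hi, mul_smul, H.pow_succ_smul_standardGenerator, smul_zero,
    smul_zero]

theorem IsStandardType.exists_linearMap_standardGenerator_eq (H : IsStandardType i h k n) {a : N}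
    (ha : p ^ (i + 1) • a = 0) (hh : a ∈ p ^ h • (⊤ : Submodule Λ N))
    (hk : p ^ i • a ∈ p ^ k • (⊤ : Submodule Λ N)) :
    ∃ ψ : StandardModule p k n →ₗ[Λ] N, ψ (standardGenerator p i h k n) = a := by
  obtain ⟨c, hc⟩ := mem_smul_top_iff_exists.1 hh
  obtain ⟨b, hb⟩ := mem_smul_top_iff_exists.1 hk
  cases H with
  | picket _ =>
    have hc0 : p ^ (h + i + 1) • c = 0 := by
      rw [add_assoc, add_comm, pow_add, mul_smul, ← hc, ha]
    obtain ⟨ψ, hψ⟩ := exists_linearMap_one_eq hc0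
    refine ⟨ψ ∘ₗ LinearMap.fst Λ _ _, ?_⟩
    rw [standardGenerator, LinearMap.comp_apply, LinearMap.fst_apply, map_smul, hψ,
      Nat.add_sub_cancel, hc]
  | bipicket hgap =>
    have hb0 : p ^ (k + 1) • b = 0 := by
      rw [pow_succ', mul_smul, ← hb, ← mul_smul, ← pow_succ', ha]
    have hd0 : p ^ (h + 1) • (c - p ^ (k - 1 - h) • b) = 0 := by
      rw [smul_sub, smul_smul, ← pow_add, show h + 1 + (k - 1 - h) = k by omega, ← hb, hc,
        smul_smul, ← pow_add, add_comm 1 h, sub_self]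
    obtain ⟨ψ₁, hψ₁⟩ := exists_linearMap_one_eq hb0
    obtain ⟨ψ₂, hψ₂⟩ := exists_linearMap_one_eq hd0
    refine ⟨ψ₁.coprod ψ₂, ?_⟩
    rw [standardGenerator, LinearMap.coprod_apply, map_smul, map_smul, hψ₁, hψ₂, smul_sub,
      smul_smul, pow_mul_pow_sub p (show h ≤ k - 1 by omega), ← hc, add_sub_cancel]

end CommRing

section IsDomain

variable {Λ : Type*} [CommRing Λ] [IsDomain Λ] {p : Λ} {i h k n : ℕ}

theorem pow_smul_one_mem_iff (hp : Prime p) {j m : ℕ} (hj : j < n) :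
    p ^ j • (1 : Λ ⧸ Ideal.span {p ^ n}) ∈ p ^ m • (⊤ : Submodule Λ (Λ ⧸ Ideal.span {p ^ n})) ↔
      m ≤ j := by
  refine ⟨fun hmem ↦ ?_, fun hmj ↦
    pow_smul_top_antitone p hmj (mem_smul_top_iff_exists.2 ⟨1, rfl⟩)⟩
  by_contra! hjm
  obtain ⟨x, hx⟩ := mem_smul_top_iff_exists.1 hmem
  obtain ⟨s, rfl⟩ := exists_smul_one_eq _ x
  rw [smul_smul, ← sub_eq_zero, ← sub_smul, smul_one_eq_zero_iff] at hx
  have hdvd : p ^ (j + 1) ∣ p ^ j := by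
    rw [← dvd_sub_left ((pow_dvd_pow p hjm).mul_right s)]
    exact (pow_dvd_pow p hj).trans hx
  exact ((pow_dvd_pow_iff hp.ne_zero hp.not_isUnit).1 hdvd).not_gt j.lt_succ_self

theorem IsStandardType.isHeight_standardGenerator (H : IsStandardType i h k n) (hp : Prime p) :
    IsHeight p (standardGenerator p i h k n) h := by
  rw [isHeight_iff, standardGenerator, mk_mem_smul_top_iff, mk_mem_smul_top_iff,
    pow_smul_one_mem_iff hp (show k - i < k + 1 by omega),
    pow_smul_one_mem_iff hp (show k - i < k + 1 by omega)]
  cases H with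
  | picket _ => exact ⟨⟨by omega, mem_smul_top_iff_exists.2 ⟨1, rfl⟩⟩, fun hx ↦ by omega⟩
  | bipicket hk =>
    rw [pow_smul_one_mem_iff hp h.lt_succ_self, pow_smul_one_mem_iff hp h.lt_succ_self]
    omega

theorem IsStandardType.isHeight_pow_smul_standardGenerator (H : IsStandardType i h k n)
    (hp : Prime p) : IsHeight p (p ^ i • standardGenerator p i h k n) k := by
  rw [H.pow_smul_standardGenerator, isHeight_iff, mk_mem_smul_top_iff, mk_mem_smul_top_iff,
    pow_smul_one_mem_iff hp k.lt_succ_self, pow_smul_one_mem_iff hp k.lt_succ_self]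
  exact ⟨⟨le_rfl, Submodule.zero_mem _⟩, fun h ↦ h.1.not_gt k.lt_succ_self⟩

theorem IsStandardType.pow_smul_standardGenerator_ne_zero (H : IsStandardType i h k n)
    (hp : Prime p) : p ^ i • standardGenerator p i h k n ≠ 0 :=
  (H.isHeight_pow_smul_standardGenerator hp).ne_zero

theorem IsStandardType.standardGenerator_ne_zero (H : IsStandardType i h k n) (hp : Prime p) :
    standardGenerator p i h k n ≠ 0 :=
  (H.isHeight_standardGenerator hp).ne_zero

theorem IsStandardType.isHeightSequence (H : IsStandardType i h k n) (hp : Prime p) :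
    IsHeightSequence p (standardGenerator p i h k n) ([h, k].take (i + 1)) := by
  have hh := H.isHeight_standardGenerator hp
  have hk := H.isHeight_pow_smul_standardGenerator hp
  have h0 := H.pow_succ_smul_standardGenerator (p := p)
  have hi : i ≤ 1 := by cases H <;> omega
  interval_cases i
  · exact isHeightSequence_singleton hh.ne_zero (by simpa using h0) hh
  · rw [pow_one] at hk
    exact isHeightSequence_pair hk.ne_zero h0 hh hk

theorem IsStandardType.snd_apply_eq_of_smul_eq_zero (H : IsStandardType i h k n) (hp : p ≠ 0)
    {θ : StandardModule p k n →ₗ[Λ] StandardModule p k n}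
    (hθ : θ (standardGenerator p i h k n) = standardGenerator p i h k n)
    {z : StandardModule p k n} (hz : p • z = 0) : (θ z).2 = z.2 := by
  cases H with
  | picket _ =>
    have := subsingleton_quotient_span_pow_zero p
    exact Subsingleton.elim _ _
  | bipicket hk =>
    obtain ⟨x, hx⟩ := exists_eq_smul_of_smul_eq_zero (pow_succ' p k) hp (congrArg Prod.fst hz)
    obtain ⟨y, hy⟩ := exists_eq_smul_of_smul_eq_zero (pow_succ' p h) hp (congrArg Prod.snd hz)
    obtain ⟨s, rfl⟩ := exists_smul_one_eq _ y
    have hsnd {j : ℕ} (hj : h + 1 ≤ j) (w : StandardModule p k (h + 1)) : (p ^ j • w).2 = 0 :=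
      smul_quotient_eq_zero (pow_dvd_pow p hj) w.2
    have hz' : z = p ^ k • (x, 0) +
        s • (standardGenerator p 1 h k (h + 1) - p ^ (k - 1) • (1, 0)) :=
      Prod.ext (by simp [standardGenerator, hx]) (by simp [standardGenerator, hy, smul_comm s])
    rw [hz', map_add, map_smul, map_smul, map_sub, map_smul, hθ]
    simp only [Prod.snd_add, Prod.smul_snd s, Prod.snd_sub, hsnd hk.le,
      hsnd (show h + 1 ≤ k - 1 by omega)]

theorem isArtinian_standardModule [IsPrincipalIdealRing Λ] (hp : p ≠ 0) :
    IsArtinian Λ (StandardModule p k n) := by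
  have (j : ℕ) : IsArtinian Λ (Λ ⧸ Ideal.span {p ^ j}) :=
    (isFiniteLength_iff_isNoetherian_isArtinian.1 (isFiniteLength_quotient_span_singleton Λ
      (mem_nonZeroDivisors_of_ne_zero (pow_ne_zero j hp)))).2
  infer_instance

theorem IsStandardType.isLeftMinimal [IsPrincipalIdealRing Λ] (H : IsStandardType i h k n)
    (hp : p ≠ 0) : IsLeftMinimal Λ (standardGenerator p i h k n) := by
  intro θ hθ
  have := isArtinian_standardModule (k := k) (n := n) hp
  refine IsArtinian.bijective_of_injective_endomorphism θ
    (injective_of_forall_smul_eq_zero (p := p) (m := k + 1 + n) (fun x ↦ ?_) fun z hz hz0 ↦ ?_)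
  · exact Prod.ext (smul_quotient_eq_zero (pow_dvd_pow p le_self_add) x.1)
      (smul_quotient_eq_zero (pow_dvd_pow p le_add_self) x.2)
  · have hsnd : z.2 = 0 := by rw [← H.snd_apply_eq_of_smul_eq_zero hp hθ hz, hz0, Prod.snd_zero]
    obtain ⟨y, hy⟩ := exists_eq_smul_of_smul_eq_zero (pow_succ' p k) hp (congrArg Prod.fst hz)
    obtain ⟨s, rfl⟩ := exists_smul_one_eq _ y
    have hz' : z = s • p ^ i • standardGenerator p i h k n := by
      rw [H.pow_smul_standardGenerator, Prod.smul_mk, smul_zero, smul_comm s]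
      exact Prod.ext hy hsnd
    rw [hz', ← hθ, ← map_smul, ← map_smul, ← hz', hz0]

theorem IsStandardType.isIndecomposablePair [IsPrincipalIdealRing Λ] (H : IsStandardType i h k n)
    (hp : Prime p) : IsIndecomposablePair (Submodule.span Λ {standardGenerator p i h k n}) := by
  refine (H.isLeftMinimal hp.ne_zero).isIndecomposablePair (H.standardGenerator_ne_zero hp) ?_
  rw [torsionOf_eq_span_pow hp H.pow_succ_smul_standardGenerator
    (H.pow_smul_standardGenerator_ne_zero hp)]
  exact (isPrimeIdealPower_span_pow hp i.succ_ne_zero).infIrred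

theorem IsStandardType.exists_linearMap_standardModule [IsPrincipalIdealRing Λ]
    (H : IsStandardType i h k n) (hp : p ≠ 0) {B : Type*} [AddCommGroup B] [Module Λ B]
    {C : Type*} [AddCommGroup C] [Module Λ C] {j : C →ₗ[Λ] B}
    {f : C →ₗ[Λ] Λ ⧸ Ideal.span {p ^ (i + 1)}}
    (hk : ∀ x, j x ∈ p ^ (k + 1) • (⊤ : Submodule Λ B) → f x = 0)
    (hh : ∀ x, j x ∈ p ^ (h + 1) • (⊤ : Submodule Λ B) → p ^ i • f x = 0) :
    ∃ φ : B →ₗ[Λ] StandardModule p k n,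
      ∀ (x : C) (s : Λ), f x = s • 1 → φ (j x) = s • standardGenerator p i h k n := by
  obtain ⟨g, hg⟩ := exists_linearMap_one_eq (H.pow_succ_smul_standardGenerator (p := p))
  have hsnd (x : C) (hx : j x ∈ p ^ n • (⊤ : Submodule Λ B)) : (g (f x)).2 = 0 := by
    cases H with
    | picket _ =>
      have := subsingleton_quotient_span_pow_zero p
      exact Subsingleton.elim _ _
    | bipicket _ =>
      obtain ⟨y, hy⟩ := exists_eq_smul_of_smul_eq_zero (pow_succ p 1) (pow_ne_zero 1 hp) (hh x hx)
      obtain ⟨s, rfl⟩ := exists_smul_one_eq _ y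
      have hdvd : p ^ (h + 1) ∣ p * s * p ^ h := ⟨s, by ring⟩
      simp [hy, hg, standardGenerator, smul_smul, smul_one_eq_zero_iff.2 hdvd]
  obtain ⟨φ₁, hφ₁⟩ := exists_linearMap_comp_eq (pow_ne_zero (k + 1) hp) j
    (LinearMap.fst Λ _ _ ∘ₗ g ∘ₗ f) fun x hx ↦ by simp [hk x hx]
  obtain ⟨φ₂, hφ₂⟩ := exists_linearMap_comp_eq (pow_ne_zero n hp) j
    (LinearMap.snd Λ _ _ ∘ₗ g ∘ₗ f) hsnd
  refine ⟨φ₁.prod φ₂, fun x s hs ↦ ?_⟩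
  calc φ₁.prod φ₂ (j x) = g (f x) :=
        Prod.ext (LinearMap.congr_fun hφ₁ x) (LinearMap.congr_fun hφ₂ x)
    _ = s • standardGenerator p i h k n := by rw [hs, map_smul, hg]

end IsDomain

section Classification

variable {Λ : Type*} [CommRing Λ] [IsDomain Λ] [IsPrincipalIdealRing Λ] {p : Λ}
  {B : Type*} [AddCommGroup B] [Module Λ B] [Module.Finite Λ B] {A : Submodule Λ B}

theorem IsIndecomposablePair.exists_isStandardType_of_not_isPowBounded {i : ℕ}
    (hA : IsIndecomposablePair A) (hp : Prime p) (hi1 : i ≤ 1) (hbdd : IsPowBounded p (i + 1) A)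
    (hi : ¬ IsPowBounded p i A) :
    ∃ h k n, IsStandardType i h k n ∧
      PairIso (Submodule.span Λ {standardGenerator p i h k n}) A := by
  obtain ⟨a, ha, h, k, hh, hk, hnot⟩ := hbdd.exists_pow_smul_notMem hi
  have hle : h + i ≤ k := by
    obtain ⟨b, rfl⟩ := hh.1
    exact hk.2 ⟨b, by rw [smul_smul, ← pow_add, add_comm]⟩
  have h0 : i = 0 → k = h := by
    rintro rfl
    rw [pow_zero, one_smul] at hk
    exact hk.unique hh
  obtain ⟨n, H⟩ := exists_isStandardType hi1 hle h0
  obtain ⟨f, hfa, hfker⟩ := exists_linearMap_apply_eq_one (a := (⟨a, ha⟩ : A))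
    (K := (A ⊓ p ^ (k + 1) • ⊤ ⊔ p ^ i • (A ⊓ p ^ (h + 1) • ⊤)).comap A.subtype) hp
    (fun b ↦ Subtype.ext (hbdd b b.2)) hnot
  obtain ⟨φ, hφ⟩ := H.exists_linearMap_standardModule hp.ne_zero (j := A.subtype) (f := f)
    (fun x hx ↦ hfker (Submodule.mem_sup_left ⟨x.2, hx⟩)) fun x hx ↦ by
      rw [← map_smul]
      exact hfker (Submodule.mem_sup_right
        (Submodule.smul_mem_pointwise_smul (x : B) (p ^ i) _ ⟨x.2, hx⟩))
  obtain ⟨ψ, hψ⟩ := H.exists_linearMap_standardGenerator_eq (hbdd a ha) (isHeight_iff.1 hh).1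
    (isHeight_iff.1 hk).1
  refine ⟨h, k, n, H, hA.pairIso_span_of_isLeftMinimal (H.standardGenerator_ne_zero hp)
    (H.isLeftMinimal hp.ne_zero) (φ := φ) (hψ ▸ ha) ?_ fun x hx ↦ ?_⟩
  · rw [hψ]
    simpa using hφ ⟨a, ha⟩ 1 (by rw [hfa, one_smul])
  · obtain ⟨s, hs⟩ := exists_smul_one_eq _ (f ⟨x, hx⟩)
    exact Submodule.mem_span_singleton.2 ⟨s, (hφ ⟨x, hx⟩ s hs.symm).symm⟩

theorem IsIndecomposablePair.exists_isStandardType (hA : IsIndecomposablePair A) (hp : Prime p)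
    (hbdd : IsPowBounded p 2 A) (hne : A ≠ ⊥) :
    ∃ i h k n, IsStandardType i h k n ∧
      PairIso (Submodule.span Λ {standardGenerator p i h k n}) A := by
  by_cases h1 : IsPowBounded p 1 A
  · refine ⟨0, hA.exists_isStandardType_of_not_isPowBounded hp zero_le_one h1 fun h0 ↦ hne ?_⟩
    exact (Submodule.eq_bot_iff A).2 fun x hx ↦ by simpa using h0 x hx
  · exact ⟨1, hA.exists_isStandardType_of_not_isPowBounded hp le_rfl hbdd h1⟩

theorem IsIndecomposablePair.exists_eq_span (hA : IsIndecomposablePair A) (hp : Prime p)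
    (hbdd : IsPowBounded p 2 A) (hne : A ≠ ⊥) : ∃ a : B, a ≠ 0 ∧ A = Submodule.span Λ {a} := by
  obtain ⟨i, h, k, n, H, e, rfl⟩ := hA.exists_isStandardType hp hbdd hne
  exact ⟨e _, e.map_ne_zero_iff.2 (H.standardGenerator_ne_zero hp),
    by rw [Submodule.map_span, Set.image_singleton, LinearEquiv.coe_coe]⟩

theorem IsIndecomposablePair.pairIso_span_of_isHeightSequence {D : Type*} [AddCommGroup D]
    [Module Λ D] [Module.Finite Λ D] {a : B} {c : D} {l : List ℕ} (hp : Prime p)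
    (ha : a ≠ 0) (ha2 : IsPowBounded p 2 (Submodule.span Λ {a}))
    (hA : IsIndecomposablePair (Submodule.span Λ {a})) (hc : c ≠ 0)
    (hc2 : IsPowBounded p 2 (Submodule.span Λ {c}))
    (hC : IsIndecomposablePair (Submodule.span Λ {c})) (hla : IsHeightSequence p a l)
    (hlc : IsHeightSequence p c l) :
    PairIso (Submodule.span Λ {a}) (Submodule.span Λ {c}) := by
  obtain ⟨i, h, k, n, H, hiso⟩ :=
    hA.exists_isStandardType hp ha2 (mt Submodule.span_singleton_eq_bot.1 ha)
  obtain ⟨i', h', k', n', H', hiso'⟩ :=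
    hC.exists_isStandardType hp hc2 (mt Submodule.span_singleton_eq_bot.1 hc)
  have hl := ((H.isHeightSequence hp).of_pairIso hiso).unique hla
  have hl' := ((H'.isHeightSequence hp).of_pairIso hiso').unique hlc
  obtain ⟨rfl, rfl, rfl, rfl⟩ := H.eq_of_take_eq H' (hl.trans hl'.symm)
  exact hiso.symm.trans hiso'

end Classification

end StandardPairs

section ZeroSubmodule

theorem eq_of_linearEquiv_quotient {R : Type*} [CommRing R] {I J : Ideal R}
    (e : (R ⧸ I) ≃ₗ[R] R ⧸ J) : I = J := by
  rw [← Ideal.annihilator_quotient (I := I), e.annihilator_eq, Ideal.annihilator_quotient]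

variable {Λ : Type*} [CommRing Λ] [IsDomain Λ] [IsPrincipalIdealRing Λ]
  {B : Type*} [AddCommGroup B] [Module Λ B] [Module.Finite Λ B]

theorem exists_quotient_retract [Nontrivial B] :
    ∃ Q : Ideal Λ, IsPrimeIdealPower Q ∧
      ∃ (φ : B →ₗ[Λ] Λ ⧸ Q) (ψ : (Λ ⧸ Q) →ₗ[Λ] B), φ ∘ₗ ψ = LinearMap.id := by
  classical
  obtain ⟨n, ι, _, q, hq, e, ⟨E⟩⟩ := Module.equiv_free_prod_directSum (R := Λ) (M := B)
  have hretract {N : Type _} [AddCommGroup N] [Module Λ N]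
      {φ : (Fin n →₀ Λ) × (DirectSum ι fun j ↦ Λ ⧸ Submodule.span Λ {q j ^ e j}) →ₗ[Λ] N} {ψ}
      (h : φ ∘ₗ ψ = LinearMap.id) :
      ∃ (φ : B →ₗ[Λ] N) (ψ : N →ₗ[Λ] B), φ ∘ₗ ψ = LinearMap.id :=
    ⟨φ ∘ₗ E, E.symm ∘ₗ ψ, by rw [← h]; ext x; simp⟩
  by_cases he : ∃ j, e j ≠ 0
  · obtain ⟨j, hj⟩ := he
    refine ⟨_, isPrimeIdealPower_span_pow (hq j).prime hj, hretract
      (φ := DirectSum.component Λ ι (fun j ↦ Λ ⧸ Submodule.span Λ {q j ^ e j}) j ∘ₗ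
        LinearMap.snd Λ _ _)
      (ψ := LinearMap.inr Λ _ _ ∘ₗ DirectSum.lof Λ ι (fun j ↦ Λ ⧸ Submodule.span Λ {q j ^ e j}) j)
      (LinearMap.ext fun x ↦ ?_)⟩
    simp [DirectSum.component.lof_self]
  rcases isEmpty_or_nonempty (Fin n) with hn | ⟨⟨j⟩⟩
  · push Not at he
    have (j : ι) : Subsingleton (Λ ⧸ Submodule.span Λ {q j ^ e j}) :=
      he j ▸ subsingleton_quotient_span_pow_zero (q j)
    have : Subsingleton (DirectSum ι fun j ↦ Λ ⧸ Submodule.span Λ {q j ^ e j}) :=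
      ⟨fun x y ↦ DFinsupp.ext fun j ↦ Subsingleton.elim _ _⟩
    exact absurd E.injective.subsingleton (not_subsingleton B)
  · let b : (Λ ⧸ (⊥ : Ideal Λ)) ≃ₗ[Λ] Λ := Submodule.quotEquivOfEqBot ⊥ rfl
    exact ⟨⊥, isPrimeIdealPower_bot, hretract
      (φ := b.symm ∘ₗ Finsupp.lapply j ∘ₗ LinearMap.fst Λ _ _)
      (ψ := LinearMap.inl Λ _ _ ∘ₗ Finsupp.lsingle j ∘ₗ b) (LinearMap.ext fun x ↦ by simp)⟩

theorem IsIndecomposablePair.existsUnique_quotient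
    (hB : IsIndecomposablePair (⊥ : Submodule Λ B)) :
    ∃! Q : Ideal Λ, IsPrimeIdealPower Q ∧
      PairIso (⊥ : Submodule Λ B) (⊥ : Submodule Λ (Λ ⧸ Q)) := by
  have := hB.1
  obtain ⟨Q, hQ, φ, ψ, hφψ⟩ := exists_quotient_retract (Λ := Λ) (B := B)
  have := Ideal.Quotient.nontrivial_iff.2 hQ.infIrred.ne_top
  obtain ⟨e, he⟩ := hB.pairIso_of_retract (C := ⊥) hφψ bot_le bot_le
  refine ⟨Q, ⟨hQ, PairIso.symm ⟨e, he⟩⟩, fun Q' ⟨_, e', _⟩ ↦ ?_⟩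
  exact eq_of_linearEquiv_quotient (e'.symm.trans e.symm)

theorem IsIndecomposablePair.xor_quotient_span {p : Λ} (hp : Prime p) {A : Submodule Λ B}
    (hA : IsIndecomposablePair A) (hbdd : IsPowBounded p 2 A) :
    Xor (∃! Q : Ideal Λ, IsPrimeIdealPower Q ∧ PairIso A (⊥ : Submodule Λ (Λ ⧸ Q)))
      (∃ a : B, a ≠ 0 ∧ A = Submodule.span Λ {a}) := by
  rcases eq_or_ne A ⊥ with rfl | hne
  · exact .inl ⟨hA.existsUnique_quotient,
      fun ⟨a, ha, hspan⟩ ↦ ha (Submodule.span_singleton_eq_bot.1 hspan.symm)⟩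
  · exact .inr ⟨hA.exists_eq_span hp hbdd hne, fun ⟨Q, ⟨_, hQ⟩, _⟩ ↦ hne (hQ.eq_bot_iff.2 rfl)⟩

end ZeroSubmodule

end SubmodulePair

theorem mainTheorem5 {Λ : Type u} [CommRing Λ] [IsDomain Λ] [IsPrincipalIdealRing Λ]
    (p : Λ) (hp : Prime p) :
    -- an indecomposable pair is of exactly one of the two kinds
    (∀ (B : Type v) [AddCommGroup B] [Module Λ B] [Module.Finite Λ B] (A : Submodule Λ B),
      IsPowBounded p 2 A → IsIndecomposablePair A →
      Xor
        (∃! Q : Ideal Λ, IsPrimeIdealPower Q ∧ PairIso A (⊥ : Submodule Λ (Λ ⧸ Q)))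
        (∃ a : B, a ≠ 0 ∧ A = Submodule.span Λ {a})) ∧
    -- the height sequence of a generator exists, is unique and has length at most 2
    (∀ (B : Type v) [AddCommGroup B] [Module Λ B] [Module.Finite Λ B] (a : B),
      a ≠ 0 → IsPowBounded p 2 (Submodule.span Λ {a}) →
      IsIndecomposablePair (Submodule.span Λ {a}) →
      ∃ l : List ℕ, l.length ≤ 2 ∧ ∀ l' : List ℕ, IsHeightSequence p a l' ↔ l' = l) ∧
    -- the height sequence of a generator is a complete isomorphism invariant
    (∀ (B : Type v) [AddCommGroup B] [Module Λ B] [Module.Finite Λ B] (a : B)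
      (D : Type w) [AddCommGroup D] [Module Λ D] [Module.Finite Λ D] (c : D),
      a ≠ 0 → IsPowBounded p 2 (Submodule.span Λ {a}) →
      IsIndecomposablePair (Submodule.span Λ {a}) →
      c ≠ 0 → IsPowBounded p 2 (Submodule.span Λ {c}) →
      IsIndecomposablePair (Submodule.span Λ {c}) →
      ∀ l : List ℕ, IsHeightSequence p a l →
        (PairIso (Submodule.span Λ {a}) (Submodule.span Λ {c}) ↔ IsHeightSequence p c l)) ∧
    -- every power of a prime ideal is realized
    (∀ Q : Ideal Λ, IsPrimeIdealPower Q →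
      IsIndecomposablePair (⊥ : Submodule Λ (Λ ⧸ Q))) ∧
    -- height sequences of nonzero elements are nonempty and strictly increasing
    (∀ (M : Type v) [AddCommGroup M] [Module Λ M] (x : M) (l : List ℕ),
      x ≠ 0 → IsHeightSequence p x l → l ≠ [] ∧ l.Pairwise (· < ·)) ∧
    -- every such sequence of length at most 2 is realized
    (∀ l : List ℕ, l ≠ [] → l.Pairwise (· < ·) → l.length ≤ 2 →
      ∃ (B : Type u) (_ : AddCommGroup B) (_ : Module Λ B) (a : B),
        Module.Finite Λ B ∧ a ≠ 0 ∧ IsPowBounded p 2 (Submodule.span Λ {a}) ∧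
        IsIndecomposablePair (Submodule.span Λ {a}) ∧ IsHeightSequence p a l) := by
  refine ⟨fun B _ _ _ A hA hind ↦ hind.xor_quotient_span hp hA, fun B _ _ _ a _ hA _ ↦ ?_,
    fun B _ _ _ a D _ _ _ c ha hA hind hc hC hind' l hl ↦
      ⟨hl.of_pairIso, hind.pairIso_span_of_isHeightSequence hp ha hA hc hC hind' hl⟩,
    fun Q hQ ↦ isIndecomposablePair_bot_quotient_of_infIrred hQ.infIrred,
    fun M _ _ x l hx hl ↦ ⟨hl.ne_nil hx, hl.pairwise_lt⟩, fun l hne hl hlen ↦ ?_⟩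
  · obtain ⟨l, hlen, hl⟩ := hA.exists_isHeightSequence
    exact ⟨l, hlen, fun l' ↦ ⟨fun hl' ↦ hl'.unique hl, fun hl' ↦ hl' ▸ hl⟩⟩
  · obtain ⟨i, h, k, n, H, rfl⟩ := exists_isStandardType_take_eq hne hl hlen
    exact ⟨StandardModule p k n, inferInstance, inferInstance, standardGenerator p i h k n,
      inferInstance, H.standardGenerator_ne_zero hp, H.isPowBounded, H.isIndecomposablePair hp,
      H.isHeightSequence hp⟩
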